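/- Let $d>1$ be an integer, $1\le p,q\le\infty$ and $r>0$. Fix a non-negative function $\varphi_0\in C_0^\infty(\mathbb R)$ with $\varphi_0\equiv1$ on $[-1,1]$ and $\operatorname{supp}\varphi_0\subset[-\tfrac32,\tfrac32]$. Put $\varphi_j(t)=\varphi_0(2^{-j}t)-\varphi_0(2^{-j+1}t)$ for $t\in\mathbb R$, $j\in\mathbb N$, and $\varphi_k(\xi)=\varphi_{k_1}(\xi_1)\cdots\varphi_{k_d}(\xi_d)$ and $|k|_1=k_1+\dots+k_d$ for $k\in\mathbb N_0^d$, $\xi\in\mathbb R^d$. Let $\mathcal F$ be the Fourier transform on $\mathcal S'(\mathbb R^d)$ that extends $\mathcal F\psi(\xi)=(2\pi)^{-d/2}\int_{\mathbb R^d}e^{-ix\cdot\xi}\psi(x)\,dx$, $\psi\in\mathcal S(\mathbb R^d)$. For $f\in\mathcal S'(\mathbb R^d)$ put $$\|f\,|S^r_{p,q}B(\mathbb R^d)\|=\Big(\sum_{k\in\mathbb N_0^d}2^{r|k|_1q}\,\big\|\mathcal F^{-1}[\varphi_k\mathcal Ff]\,\big|L_p(\mathbb R^d)\big\|^q\Big)^{1/q}\in[0,\infty]$$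 (the supremum of $2^{r|k|_1}\|\mathcal F^{-1}[\varphi_k\mathcal Ff]\,|L_p(\mathbb R^d)\|$ over $k\in\mathbb N_0^d$ if $q=\infty$), where the $L_p$-norm of a tempered distribution that is not in $L_p(\mathbb R^d)$ is $\infty$. The Besov space of dominating mixed smoothness $S^r_{p,q}B(\mathbb R^d)$ consists of all $f\in\mathcal S'(\mathbb R^d)$ for which this is finite. Then there exists no constant $C>0$ such that $$\|f\cdot g\,|S^r_{p,q}B(\mathbb R^d)\|\le C\big(\|f\,|S^r_{p,q}B(\mathbb R^d)\|\,\|g\,|L_\infty(\mathbb R^d)\|+\|f\,|L_\infty(\mathbb R^d)\|\,\|g\,|S^r_{p,q}B(\mathbb R^d)\|\big)$$ holds for all complex-valued $f,g\in S^r_{p,q}B(\mathbb R^d)\cap L_\infty(\mathbb R^d)$. -/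

import Mathlib

open MeasureTheory
open scoped ENNReal NNReal SchwartzMap

noncomputable section

namespace MixedBesov

/-- `ℝ^d` with its Euclidean structure. -/
abbrev Rn (d : ℕ) : Type := EuclideanSpace ℝ (Fin d)

/-- Generators `φ₀` of a smooth dyadic decomposition of unity on the real line: non-negative
`C₀^∞`-functions that equal `1` on `[-1, 1]` and have support in `[-3/2, 3/2]`. -/
structure IsDyadicGenerator (φ₀ : ℝ → ℝ) : Prop where
  contDiff : ContDiff ℝ ((⊤ : ℕ∞) : WithTop ℕ∞) φ₀
  nonneg : ∀ t, 0 ≤ φ₀ t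
  eq_one : ∀ t ∈ Set.Icc (-1 : ℝ) 1, φ₀ t = 1
  tsupport_subset : tsupport φ₀ ⊆ Set.Icc (-(3 / 2) : ℝ) (3 / 2)

/-- The dyadic pieces on the line: the given `φ₀` for `j = 0`, and
`φ_j(t) = φ₀(2^{-j} t) - φ₀(2^{-j+1} t)` for `j ≥ 1`. -/
def dyadicPiece (φ₀ : ℝ → ℝ) : ℕ → ℝ → ℝ
  | 0, t => φ₀ t
  | j + 1, t => φ₀ (t / 2 ^ (j + 1)) - φ₀ (t / 2 ^ j)

/-- The tensor product pieces `φ_k(ξ) = φ_{k_1}(ξ_1) ⋯ φ_{k_d}(ξ_d)` for `k ∈ ℕ₀^d`. -/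
def tensorPiece (φ₀ : ℝ → ℝ) {d : ℕ} (k : Fin d → ℕ) (ξ : Rn d) : ℝ :=
  ∏ i, dyadicPiece φ₀ (k i) (ξ i)

/-- The building block `𝓕⁻¹[φ_k 𝓕 f]` of a tempered distribution, for the Fourier transform
`(𝓕 f)(ξ) = (2π)^{-d/2} ∫ e^{-i x·ξ} f(x) dx`. Mathlib's Fourier transform has the kernel
`e^{-2π i x·ξ}`, so in terms of the latter the same operator has the symbol `ξ ↦ φ_k(2π ξ)`. -/
def block (φ₀ : ℝ → ℝ) {d : ℕ} (k : Fin d → ℕ) (f : 𝓢'(Rn d, ℂ)) : 𝓢'(Rn d, ℂ) :=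
  TemperedDistribution.fourierMultiplierCLM ℂ
    (fun ξ : Rn d => (tensorPiece φ₀ k ((2 * Real.pi) • ξ) : ℂ)) f

/-- The norm `‖T | L_p(ℝ^d)‖ ∈ [0, ∞]` of a tempered distribution: it is `‖u | L_p‖` if `T` is
the regular distribution of some (then unique) `u ∈ L_p(ℝ^d)`, and `∞` if there is no such `u`. -/
def lpNorm {d : ℕ} (p : ℝ≥0∞) [Fact (1 ≤ p)] (T : 𝓢'(Rn d, ℂ)) : ℝ≥0∞ :=
  ⨅ (u : Lp ℂ p (volume : Measure (Rn d))) (_ : Lp.toTemperedDistribution u = T),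
    eLpNorm u p volume

/-- The `ℓ_q` norm of a family with values in `[0, ∞]`. -/
def lqNorm {ι : Type} (q : ℝ≥0∞) (a : ι → ℝ≥0∞) : ℝ≥0∞ :=
  if q = ∞ then ⨆ k, a k else (∑' k, a k ^ q.toReal) ^ (1 / q.toReal)

/-- The norm `‖f | S^r_{p,q}B(ℝ^d)‖_φ ∈ [0, ∞]` of a tempered distribution `f`, i.e.
`(∑_{k ∈ ℕ₀^d} 2^{r |k|₁ q} ‖𝓕⁻¹[φ_k 𝓕 f] | L_p‖^q)^{1/q}`, a supremum if `q = ∞`. -/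
def besovNorm (φ₀ : ℝ → ℝ) {d : ℕ} (r : ℝ) (p q : ℝ≥0∞) [Fact (1 ≤ p)]
    (f : 𝓢'(Rn d, ℂ)) : ℝ≥0∞ :=
  lqNorm q fun k : Fin d → ℕ =>
    (2 : ℝ≥0∞) ^ (r * ∑ i, (k i : ℝ)) * lpNorm p (block φ₀ k f)

/-- The Besov space of dominating mixed smoothness `S^r_{p,q}B(ℝ^d)`. -/
def besovSpace (φ₀ : ℝ → ℝ) (d : ℕ) (r : ℝ) (p q : ℝ≥0∞) [Fact (1 ≤ p)] :
    Set 𝓢'(Rn d, ℂ) :=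
  {f | besovNorm φ₀ r p q f < ∞}

end MixedBesov

end

open FourierTransform Filter Topology
open scoped Convolution

namespace MixedBesov

/-! The right-hand side carries dyadic weight in only one factor at a time, while a product can be
of high frequency in two coordinates at once. Modulate one band-limited Schwartz function to
frequency about `2 ^ n` in the first coordinate for `f`, and in the second for `g`. Each then
consists of a single block, with Besov norm `X * E` for `X = 2 ^ (r * (n + 3))`, whereas `f * g` is
a single block with norm `X ^ 2 * B`. Modulation leaves absolute values unchanged, so `E`, `B` and
the sup norm `M` do not depend on `n`. The inequality would give `X * B ≤ C * (E * M + M * E)`,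
which fails for large `n` since `r > 0` and `B ≠ 0`. The single-block computation is
`besovNorm_of_fourier_near_freqCenter`; `exists_add_of_fourier_schwartzMul_ne_zero` locates the
spectrum of the product. -/

lemma IsDyadicGenerator.eq_zero {φ₀ : ℝ → ℝ} (h : IsDyadicGenerator φ₀) {t : ℝ}
    (ht : 3 / 2 < |t|) : φ₀ t = 0 := by
  by_contra hne
  have := h.tsupport_subset (subset_tsupport _ (Function.mem_support.2 hne))
  exact absurd (abs_le.2 this) (not_le.2 ht)

lemma IsDyadicGenerator.eq_one_of_abs_le {φ₀ : ℝ → ℝ} (h : IsDyadicGenerator φ₀) {t : ℝ}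
    (ht : |t| ≤ 1) : φ₀ t = 1 :=
  h.eq_one t (abs_le.1 ht)

lemma dyadicPiece_zero_eq_one {φ₀ : ℝ → ℝ} (h : IsDyadicGenerator φ₀) {t : ℝ} (ht : |t| ≤ 1) :
    dyadicPiece φ₀ 0 t = 1 :=
  h.eq_one_of_abs_le ht

/-- On `|t| ≤ 2 ^ j`, every piece with index larger than `j` vanishes. -/
lemma dyadicPiece_eq_zero_of_abs_le {φ₀ : ℝ → ℝ} (h : IsDyadicGenerator φ₀) {t : ℝ} {j l : ℕ}
    (ht : |t| ≤ 2 ^ j) (hl : j < l) : dyadicPiece φ₀ l t = 0 := by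
  obtain ⟨m, rfl⟩ := Nat.exists_eq_succ_of_ne_zero (Nat.ne_zero_of_lt hl)
  have key : ∀ i, j ≤ i → φ₀ (t / 2 ^ i) = 1 := fun i hi => h.eq_one_of_abs_le <| by
    rw [abs_div, abs_of_pos (by positivity : (0 : ℝ) < 2 ^ i), div_le_one (by positivity)]
    exact ht.trans (pow_le_pow_right₀ one_le_two hi)
  simp only [dyadicPiece]
  rw [key _ (by omega), key _ (by omega), sub_self]

/-- On `3 / 2 * 2 ^ j < |t|`, every piece with index at most `j` vanishes. -/
lemma dyadicPiece_eq_zero_of_lt_abs {φ₀ : ℝ → ℝ} (h : IsDyadicGenerator φ₀) {t : ℝ} {j l : ℕ}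
    (ht : 3 / 2 * 2 ^ j < |t|) (hl : l ≤ j) : dyadicPiece φ₀ l t = 0 := by
  have key : ∀ i, i ≤ j → φ₀ (t / 2 ^ i) = 0 := fun i hi => h.eq_zero <| by
    rw [abs_div, abs_of_pos (by positivity : (0 : ℝ) < 2 ^ i), lt_div_iff₀ (by positivity)]
    refine lt_of_le_of_lt ?_ ht
    gcongr
    norm_num
  cases l with
  | zero => simpa [dyadicPiece] using key 0 (Nat.zero_le _)
  | succ m =>
    simp only [dyadicPiece]
    rw [key _ hl, key _ (by omega), sub_self]

/-- On the shell `3 / 2 * 2 ^ j < |t| ≤ 2 ^ (j + 1)` the piece with index `j + 1` equals one. -/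
lemma dyadicPiece_succ_eq_one {φ₀ : ℝ → ℝ} (h : IsDyadicGenerator φ₀) {t : ℝ} {j : ℕ}
    (ht : 3 / 2 * 2 ^ j < |t|) (ht' : |t| ≤ 2 ^ (j + 1)) : dyadicPiece φ₀ (j + 1) t = 1 := by
  simp only [dyadicPiece]
  rw [h.eq_one_of_abs_le (t := t / 2 ^ (j + 1)), h.eq_zero (t := t / 2 ^ j), sub_zero]
  · rwa [abs_div, abs_of_pos (by positivity : (0 : ℝ) < 2 ^ j), lt_div_iff₀ (by positivity)]
  · rwa [abs_div, abs_of_pos (by positivity : (0 : ℝ) < 2 ^ (j + 1)), div_le_one (by positivity)]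

/-- The points at which the piece with index `j` equals one and all others vanish. -/
def plateau (φ₀ : ℝ → ℝ) (j : ℕ) : Set ℝ :=
  {t | dyadicPiece φ₀ j t = 1 ∧ ∀ l, l ≠ j → dyadicPiece φ₀ l t = 0}

lemma mem_plateau_zero {φ₀ : ℝ → ℝ} (h : IsDyadicGenerator φ₀) {t : ℝ} (ht : |t| ≤ 1) :
    t ∈ plateau φ₀ 0 :=
  ⟨dyadicPiece_zero_eq_one h ht, fun _ hl =>
    dyadicPiece_eq_zero_of_abs_le h (j := 0) (by simpa using ht) (Nat.pos_of_ne_zero hl)⟩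

lemma mem_plateau_succ {φ₀ : ℝ → ℝ} (h : IsDyadicGenerator φ₀) {t : ℝ} {j : ℕ}
    (ht : 3 / 2 * 2 ^ j < |t|) (ht' : |t| ≤ 2 ^ (j + 1)) : t ∈ plateau φ₀ (j + 1) := by
  refine ⟨dyadicPiece_succ_eq_one h ht ht', fun l hl => ?_⟩
  rcases lt_or_gt_of_ne hl with hl | hl
  · exact dyadicPiece_eq_zero_of_lt_abs h ht (by omega)
  · exact dyadicPiece_eq_zero_of_abs_le h ht' hl

/-! ### Tensor pieces and frequency blocks -/

variable {d : ℕ}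

lemma tensorPiece_of_mem_plateau {φ₀ : ℝ → ℝ} {K : Fin d → ℕ} {ξ : Rn d}
    (hξ : ∀ i, ξ i ∈ plateau φ₀ (K i)) (k : Fin d → ℕ) :
    tensorPiece φ₀ k ξ = if k = K then 1 else 0 := by
  split_ifs with hk
  · subst hk
    exact Finset.prod_eq_one fun i _ => (hξ i).1
  · obtain ⟨i, hi⟩ := Function.ne_iff.1 hk
    exact Finset.prod_eq_zero (Finset.mem_univ i) ((hξ i).2 _ hi)

lemma IsDyadicGenerator.contDiff_dyadicPiece {φ₀ : ℝ → ℝ} (h : IsDyadicGenerator φ₀) (j : ℕ) :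
    ContDiff ℝ ((⊤ : ℕ∞) : WithTop ℕ∞) (dyadicPiece φ₀ j) := by
  have h₀ := h.contDiff
  cases j with
  | zero => exact h₀
  | succ j =>
    have : dyadicPiece φ₀ (j + 1) = fun t => φ₀ (t / 2 ^ (j + 1)) - φ₀ (t / 2 ^ j) := rfl
    rw [this]
    exact (h₀.comp (contDiff_id.div_const _)).sub (h₀.comp (contDiff_id.div_const _))

lemma IsDyadicGenerator.dyadicPiece_eq_zero {φ₀ : ℝ → ℝ} (h : IsDyadicGenerator φ₀) {j : ℕ}
    {t : ℝ} (ht : 3 / 2 * 2 ^ j < |t|) : dyadicPiece φ₀ j t = 0 :=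
  dyadicPiece_eq_zero_of_lt_abs h ht le_rfl

lemma hasTemperateGrowth_symbol {φ₀ : ℝ → ℝ} (h : IsDyadicGenerator φ₀) (k : Fin d → ℕ) :
    Function.HasTemperateGrowth
      (fun ξ : Rn d => (tensorPiece φ₀ k ((2 * Real.pi) • ξ) : ℂ)) := by
  refine HasCompactSupport.hasTemperateGrowth ?_ ?_
  -- The box for the unscaled symbol also serves here, because `2 * π ≥ 1` only shrinks the support.
  · refine HasCompactSupport.of_support_subset_isCompact
      (K := (fun x : Fin d → ℝ => (WithLp.toLp 2 x : Rn d)) ''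
        Set.pi Set.univ fun i => Set.Icc (-(3 / 2 * 2 ^ k i)) (3 / 2 * 2 ^ k i)) ?_ ?_
    · exact (isCompact_univ_pi fun i => isCompact_Icc).image (PiLp.continuous_toLp 2 _)
    · intro ξ hξ
      refine ⟨fun i => ξ i, fun i _ => ?_, rfl⟩
      rw [Set.mem_Icc, ← abs_le]
      by_contra! hi
      refine hξ ?_
      have : tensorPiece φ₀ k ((2 * Real.pi) • ξ) = 0 := by
        refine Finset.prod_eq_zero (Finset.mem_univ i) (h.dyadicPiece_eq_zero ?_)
        simp only [PiLp.smul_apply, smul_eq_mul, abs_mul]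
        refine hi.trans_le (le_mul_of_one_le_left (abs_nonneg _) ?_)
        rw [abs_of_pos Real.pi_pos, abs_two]
        linarith [Real.two_le_pi]
      simp [this]
  · have : ContDiff ℝ ((⊤ : ℕ∞) : WithTop ℕ∞)
        (fun ξ : Rn d => tensorPiece φ₀ k ((2 * Real.pi) • ξ)) := by
      unfold tensorPiece
      refine contDiff_prod fun i _ => (h.contDiff_dyadicPiece _).comp ?_
      fun_prop
    exact Complex.ofRealCLM.contDiff.comp this

/-- A Schwartz function whose Fourier transform lives where only the piece `φ_K` is active
consists of the single block with index `K`. -/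
lemma block_schwartz {φ₀ : ℝ → ℝ} (h : IsDyadicGenerator φ₀) {K : Fin d → ℕ} {F : 𝓢(Rn d, ℂ)}
    (hF : ∀ ξ, 𝓕 F ξ ≠ 0 → ∀ i, 2 * Real.pi * ξ i ∈ plateau φ₀ (K i)) (k : Fin d → ℕ) :
    block φ₀ k (F : 𝓢'(Rn d, ℂ)) = if k = K then (F : 𝓢'(Rn d, ℂ)) else 0 := by
  have hm := hasTemperateGrowth_symbol h k
  have key : SchwartzMap.smulLeftCLM ℂ
      (fun ξ : Rn d => (tensorPiece φ₀ k ((2 * Real.pi) • ξ) : ℂ)) (𝓕 F) =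
      if k = K then 𝓕 F else 0 := by
    ext ξ
    rw [SchwartzMap.smulLeftCLM_apply_apply hm]
    by_cases hξ : 𝓕 F ξ = 0
    · split_ifs <;> simp [hξ]
    · rw [tensorPiece_of_mem_plateau (K := K) (by simpa using hF ξ hξ)]
      split_ifs <;> simp
  rw [block, TemperedDistribution.fourierMultiplierCLM_toTemperedDistributionCLM_eq hm,
    SchwartzMap.fourierMultiplierCLM_apply, key]
  split_ifs
  · simp
  · have : 𝓕⁻ (0 : 𝓢(Rn d, ℂ)) = 0 := map_zero (fourierInvCLM ℂ 𝓢(Rn d, ℂ))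
    rw [this, map_zero]

/-! ### Norms of a single block -/

/-- `L_p` embeds injectively into tempered distributions, so the infimum runs over one function. -/
lemma lpNorm_toTemperedDistribution (p : ℝ≥0∞) [Fact (1 ≤ p)]
    (u : Lp ℂ p (volume : Measure (Rn d))) :
    lpNorm p (Lp.toTemperedDistribution u) = eLpNorm u p volume := by
  refine le_antisymm (iInf_le_of_le u (iInf_le_of_le rfl le_rfl)) (le_iInf₂ fun v hv => ?_)
  have hinj : Function.Injective (Lp.toTemperedDistributionCLM ℂ (volume : Measure (Rn d)) p) :=
    LinearMap.ker_eq_bot.1 Lp.ker_toTemperedDistributionCLM_eq_bot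
  rw [hinj hv]

lemma lpNorm_schwartz (p : ℝ≥0∞) [Fact (1 ≤ p)] (F : 𝓢(Rn d, ℂ)) :
    lpNorm p (F : 𝓢'(Rn d, ℂ)) = eLpNorm F p volume := by
  rw [← Lp.toTemperedDistribution_toLp_eq (p := p), lpNorm_toTemperedDistribution]
  exact eLpNorm_congr_ae (F.coeFn_toLp p)

lemma lpNorm_zero (p : ℝ≥0∞) [Fact (1 ≤ p)] : lpNorm p (0 : 𝓢'(Rn d, ℂ)) = 0 := by
  have := lpNorm_schwartz p (0 : 𝓢(Rn d, ℂ))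
  rw [map_zero] at this
  rw [this]
  exact eLpNorm_zero

lemma lqNorm_of_forall_ne {ι : Type} {q : ℝ≥0∞} (hq : 1 ≤ q) {a : ι → ℝ≥0∞} {K : ι}
    (ha : ∀ k, k ≠ K → a k = 0) : lqNorm q a = a K := by
  unfold lqNorm
  split_ifs with hqt
  · refine le_antisymm (iSup_le fun k => ?_) (le_iSup a K)
    by_cases hk : k = K
    · rw [hk]
    · simp [ha k hk]
  · have hpos : 0 < q.toReal := ENNReal.toReal_pos (zero_lt_one.trans_le hq).ne' hqt
    rw [tsum_eq_single K fun k hk => by rw [ha k hk, ENNReal.zero_rpow_of_pos hpos],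
      ← ENNReal.rpow_mul, mul_one_div_cancel hpos.ne', ENNReal.rpow_one]

lemma besovNorm_schwartz {φ₀ : ℝ → ℝ} (h : IsDyadicGenerator φ₀) (r : ℝ) (p : ℝ≥0∞) {q : ℝ≥0∞}
    [Fact (1 ≤ p)] (hq : 1 ≤ q) {K : Fin d → ℕ} {F : 𝓢(Rn d, ℂ)}
    (hF : ∀ ξ, 𝓕 F ξ ≠ 0 → ∀ i, 2 * Real.pi * ξ i ∈ plateau φ₀ (K i)) :
    besovNorm φ₀ r p q (F : 𝓢'(Rn d, ℂ)) =
      (2 : ℝ≥0∞) ^ (r * ∑ i, (K i : ℝ)) * eLpNorm F p volume := by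
  rw [besovNorm, lqNorm_of_forall_ne hq (K := K), block_schwartz h hF, if_pos rfl,
    lpNorm_schwartz]
  intro k hk
  rw [block_schwartz h hF, if_neg hk, lpNorm_zero, mul_zero]

/-! ### Products and their spectra -/

/-- The pointwise product of two Schwartz functions. -/
noncomputable def schwartzMul (F G : 𝓢(Rn d, ℂ)) : 𝓢(Rn d, ℂ) :=
  SchwartzMap.pairing (ContinuousLinearMap.mul ℂ ℂ) F G

lemma schwartzMul_apply (F G : 𝓢(Rn d, ℂ)) (x : Rn d) : schwartzMul F G x = F x * G x := rfl

lemma fourierInv_apply_eq_fourier_neg (F : 𝓢(Rn d, ℂ)) (ξ : Rn d) : 𝓕⁻ F ξ = 𝓕 F (-ξ) := by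
  rw [SchwartzMap.fourierInv_coe, SchwartzMap.fourier_coe, Real.fourierInv_eq_fourier_neg]

/-- The transform of a product is a convolution, whose support lies in the sum of the two supports.
The convolution theorem is applied to the inverse transforms, hence the reflections `ξ ↦ -ξ`. -/
lemma exists_add_of_fourier_schwartzMul_ne_zero {F G : 𝓢(Rn d, ℂ)} {ξ : Rn d}
    (hξ : 𝓕 (schwartzMul F G) ξ ≠ 0) : ∃ a b, 𝓕 F a ≠ 0 ∧ 𝓕 G b ≠ 0 ∧ a + b = ξ := by
  have h₁ : 𝓕⁻ (schwartzMul F G) =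
      SchwartzMap.convolution (ContinuousLinearMap.mul ℂ ℂ) (𝓕⁻ F) (𝓕⁻ G) := by
    rw [← fourierInv_fourier_eq (F := 𝓢(Rn d, ℂ))
      (SchwartzMap.convolution (ContinuousLinearMap.mul ℂ ℂ) (𝓕⁻ F) (𝓕⁻ G)), SchwartzMap.fourier_convolution, fourier_fourierInv_eq, fourier_fourierInv_eq, schwartzMul]
  have h₂ : 𝓕⁻ (schwartzMul F G) (-ξ) ≠ 0 := by
    rwa [fourierInv_apply_eq_fourier_neg, neg_neg]
  rw [h₁, SchwartzMap.convolution_apply] at h₂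
  obtain ⟨a, ha, b, hb, hab⟩ := support_convolution_subset _ (Function.mem_support.2 h₂)
  refine ⟨-a, -b, ?_, ?_, ?_⟩
  · rwa [← fourierInv_apply_eq_fourier_neg]
  · rwa [← fourierInv_apply_eq_fourier_neg]
  · rw [← neg_add, show a + b = -ξ from hab, neg_neg]

lemma toLp_smul_toLp (F G : 𝓢(Rn d, ℂ)) :
    (F.toLp ∞ volume • G.toLp ∞ volume : Lp ℂ ∞ (volume : Measure (Rn d))) =
      (schwartzMul F G).toLp ∞ volume := by
  refine Lp.ext ?_
  filter_upwards [Lp.coeFn_lpSMul (r := ∞) (F.toLp ∞ volume) (G.toLp ∞ volume),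
    F.coeFn_toLp ∞ volume, G.coeFn_toLp ∞ volume, (schwartzMul F G).coeFn_toLp ∞ volume]
    with x h₁ h₂ h₃ h₄
  rw [h₁, h₄, Pi.smul_apply', h₂, h₃, smul_eq_mul, schwartzMul_apply]

/-! ### Modulated test functions -/

/-- A Schwartz function with Fourier transform supported in a small ball around `0`, all
modulations of which have the same absolute value. -/
lemma exists_modulated_family (d : ℕ) {ρ : ℝ} (hρ : 0 < ρ) :
    ∃ ψ : Rn d → 𝓢(Rn d, ℂ), ψ 0 ≠ 0 ∧ (∀ a x, ‖ψ a x‖ = ‖ψ 0 x‖) ∧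
      ∀ a ξ, 𝓕 (ψ a) ξ ≠ 0 → ‖ξ - a‖ < ρ := by
  let χ : ContDiffBump (0 : Rn d) := ⟨ρ / 2, ρ, by positivity, by linarith⟩
  have hcs : HasCompactSupport (fun x => (χ x : ℂ)) :=
    χ.hasCompactSupport.comp_left (g := Complex.ofReal) Complex.ofReal_zero
  let u : 𝓢(Rn d, ℂ) := hcs.toSchwartzMap (Complex.ofRealCLM.contDiff.comp χ.contDiff)
  have hu : ∀ x, u x = (χ x : ℂ) := fun x => rfl
  refine ⟨fun a => 𝓕⁻ (u.compSubConstCLM ℂ a), ?_, ?_, ?_⟩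
  · intro (h0 : 𝓕⁻ (u.compSubConstCLM ℂ 0) = 0)
    have h1 : 𝓕 (𝓕⁻ (u.compSubConstCLM ℂ 0)) = 0 := by
      rw [h0]; exact map_zero (fourierCLM ℂ 𝓢(Rn d, ℂ))
    rw [fourier_fourierInv_eq] at h1
    have h2 := DFunLike.congr_fun h1 0
    rw [SchwartzMap.compSubConstCLM_apply, sub_zero, hu,
      χ.one_of_mem_closedBall (by simp [χ.rIn_pos.le])] at h2
    simp at h2
  -- Translation in frequency is multiplication by a unimodular character.
  · have key : ∀ a x, 𝓕⁻ (u.compSubConstCLM ℂ a) x =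
        𝐞 (inner ℝ a x) • 𝓕⁻ u x := by
      intro a x
      rw [SchwartzMap.fourierInv_coe, SchwartzMap.fourierInv_coe, Real.fourierInv_eq,
        Real.fourierInv_eq, ← integral_add_right_eq_self _ a, Circle.smul_def, ← integral_smul]
      refine integral_congr_ae (.of_forall fun v => ?_)
      simp only [SchwartzMap.compSubConstCLM_apply, add_sub_cancel_right, inner_add_left,
        AddChar.map_add_eq_mul, mul_smul]
      rw [smul_comm, Circle.smul_def (Real.fourierChar (inner ℝ a x))]
    intro a x
    rw [key, key]
    simp [Circle.norm_smul]
  · intro a ξ hξ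
    rw [fourier_fourierInv_eq, SchwartzMap.compSubConstCLM_apply, hu] at hξ
    have : ξ - a ∈ Function.support χ := fun h => hξ (by rw [h, Complex.ofReal_zero])
    rw [χ.support_eq] at this
    simpa using this

/-- The point all of whose coordinates in `s` equal `7 * 2 ^ n / (2 * π)`, the others being
zero. -/
noncomputable def freqCenter (n : ℕ) (s : Finset (Fin d)) : Rn d :=
  WithLp.toLp 2 fun i => if i ∈ s then 7 * 2 ^ n / (2 * Real.pi) else 0

lemma freqCenter_union (n : ℕ) {s t : Finset (Fin d)} (hst : Disjoint s t) :
    freqCenter n (s ∪ t) = freqCenter n s + freqCenter n t := by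
  ext i
  have : i ∈ s → i ∉ t := fun h => Finset.disjoint_left.1 hst h
  by_cases h₁ : i ∈ s <;> by_cases h₂ : i ∈ t <;> simp_all [freqCenter]

/-- `7 * 2 ^ n` is the midpoint between `3 / 2 * 2 ^ (n + 2) = 6 * 2 ^ n` and `2 ^ (n + 3) = 8 * 2 ^
n`. The margin `2 ^ n ≥ 1` absorbs the radius, which is `1` after rescaling by `2 * π`. -/
lemma mem_plateau_of_norm_sub_freqCenter_lt {φ₀ : ℝ → ℝ} (h : IsDyadicGenerator φ₀) {n : ℕ}
    {s : Finset (Fin d)} {ξ : Rn d} (hξ : ‖ξ - freqCenter n s‖ < 1 / (2 * Real.pi)) (i : Fin d) :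
    2 * Real.pi * ξ i ∈ plateau φ₀ (if i ∈ s then n + 3 else 0) := by
  have hi : |ξ i - freqCenter n s i| < 1 / (2 * Real.pi) :=
    lt_of_le_of_lt (PiLp.norm_apply_le (ξ - freqCenter n s) i) hξ
  have hpi : 0 < 2 * Real.pi := Real.two_pi_pos
  replace hi : |ξ i * (2 * Real.pi) - freqCenter n s i * (2 * Real.pi)| < 1 := by
    rwa [← sub_mul, abs_mul, abs_of_pos hpi, ← lt_div_iff₀ hpi]
  rw [mul_comm (ξ i)] at hi
  split_ifs with his
  · have hc : freqCenter n s i * (2 * Real.pi) = 7 * 2 ^ n := by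
      simp [freqCenter, his, div_mul_cancel₀ _ hpi.ne']
    rw [hc, abs_lt] at hi
    have hn : (1 : ℝ) ≤ 2 ^ n := one_le_pow₀ one_le_two
    have hpos : 0 < 2 * Real.pi * ξ i := by linarith
    refine mem_plateau_succ h (j := n + 2) ?_ ?_ <;> rw [abs_of_pos hpos] <;> ring_nf at hi ⊢ <;>
      linarith
  · have hc : freqCenter n s i = 0 := by simp [freqCenter, his]
    rw [hc, zero_mul, sub_zero] at hi
    exact mem_plateau_zero h hi.le

/-- A Schwartz function with Fourier transform near `freqCenter n s` has an explicit Besov norm. -/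
lemma besovNorm_of_fourier_near_freqCenter {φ₀ : ℝ → ℝ} (h : IsDyadicGenerator φ₀) (r : ℝ)
    (p : ℝ≥0∞) {q : ℝ≥0∞} [Fact (1 ≤ p)] (hq : 1 ≤ q) {n : ℕ} {s : Finset (Fin d)}
    {F : 𝓢(Rn d, ℂ)} (hF : ∀ ξ, 𝓕 F ξ ≠ 0 → ‖ξ - freqCenter n s‖ < 1 / (2 * Real.pi)) :
    besovNorm φ₀ r p q (Lp.toTemperedDistribution (F.toLp ∞ volume)) =
      ((2 : ℝ≥0∞) ^ (r * (n + 3))) ^ s.card * eLpNorm F p volume := by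
  rw [Lp.toTemperedDistribution_toLp_eq,
    besovNorm_schwartz h r p hq (K := fun i => if i ∈ s then n + 3 else 0)
      fun ξ hξ i => mem_plateau_of_norm_sub_freqCenter_lt h (hF ξ hξ) i,
    ← ENNReal.rpow_mul_natCast]
  congr 2
  simp only [Nat.cast_ite, Nat.cast_add, Nat.cast_ofNat, Nat.cast_zero, Finset.sum_ite_mem,
    Finset.univ_inter, Finset.sum_const, nsmul_eq_mul]
  ring

/-- The powers `2 ^ (r * (n + 3))`, `r > 0`, are not bounded by a finite constant. -/
lemma exists_lt_two_rpow_mul {r : ℝ} (hr : 0 < r) {D : ℝ≥0∞} (hD : D ≠ ∞) :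
    ∃ n : ℕ, D < (2 : ℝ≥0∞) ^ (r * (n + 3)) := by
  have h2 : (1 : ℝ≥0∞) < 2 ^ r := ENNReal.one_lt_rpow (by norm_num) hr
  obtain ⟨n, hn⟩ := ((ENNReal.tendsto_pow_atTop_nhds_top_iff.2 h2).eventually
    (lt_mem_nhds hD.lt_top)).exists
  refine ⟨n, hn.trans_le ?_⟩
  rw [← ENNReal.rpow_natCast, ← ENNReal.rpow_mul]
  exact ENNReal.rpow_le_rpow_of_exponent_le one_le_two (by gcongr; linarith)

end MixedBesov

theorem theorem3p9 (d : ℕ) (hd : 1 < d) (p q : ℝ≥0∞) [Fact (1 ≤ p)] (hq : 1 ≤ q)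
    (r : ℝ) (hr : 0 < r) (φ₀ : ℝ → ℝ) (hφ₀ : MixedBesov.IsDyadicGenerator φ₀) :
    ¬ ∃ C : ℝ≥0, 0 < C ∧
      ∀ f g : Lp ℂ ∞ (volume : Measure (MixedBesov.Rn d)),
        Lp.toTemperedDistribution f ∈ MixedBesov.besovSpace φ₀ d r p q →
        Lp.toTemperedDistribution g ∈ MixedBesov.besovSpace φ₀ d r p q →
        MixedBesov.besovNorm φ₀ r p q
            (Lp.toTemperedDistribution (f • g : Lp ℂ ∞ (volume : Measure (MixedBesov.Rn d)))) ≤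
          C * (MixedBesov.besovNorm φ₀ r p q (Lp.toTemperedDistribution f) * eLpNorm g ∞ volume
            + eLpNorm f ∞ volume *
              MixedBesov.besovNorm φ₀ r p q (Lp.toTemperedDistribution g)) := by
  rintro ⟨C, -, hC⟩
  -- Half the admissible radius, since radii add when spectra do.
  obtain ⟨ψ, hψ0, hnorm, hsupp⟩ := MixedBesov.exists_modulated_family d
    (ρ := 1 / (4 * Real.pi)) (by positivity)
  have hlt : 1 / (4 * Real.pi) < 1 / (2 * Real.pi) := by
    gcongr
    norm_num
  have hE : ∀ (t : ℝ≥0∞) a, eLpNorm (ψ a) t volume = eLpNorm (ψ 0) t volume := fun t a =>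
    eLpNorm_congr_norm_ae (.of_forall (hnorm a))
  set E := eLpNorm (ψ 0) p volume
  set M := eLpNorm (ψ 0) ∞ volume
  set B := eLpNorm (MixedBesov.schwartzMul (ψ 0) (ψ 0)) p volume with hB
  have hEp : ∀ a, eLpNorm (ψ a) p volume = E := hE p
  have hEM : ∀ a, eLpNorm (ψ a) ∞ volume = M := hE ∞
  have hEtop : E ≠ ∞ := ((ψ 0).memLp p volume).eLpNorm_ne_top
  have hMtop : M ≠ ∞ := ((ψ 0).memLp ∞ volume).eLpNorm_ne_top
  have hp0 : p ≠ 0 := (zero_lt_one.trans_le (Fact.out : 1 ≤ p)).ne'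
  have hB0 : B ≠ 0 := by
    intro h0
    rw [hB, eLpNorm_eq_zero_iff (SchwartzMap.continuous _).aestronglyMeasurable hp0] at h0
    have h1 := (SchwartzMap.continuous _).ae_eq_iff_eq volume continuous_zero |>.1 h0
    refine hψ0 (SchwartzMap.ext fun x => ?_)
    exact mul_self_eq_zero.1 (congrFun h1 x)
  -- This threshold is what the inequality leaves as a bound for `X` after one factor `X` is
  -- cancelled.
  obtain ⟨n, hn⟩ := MixedBesov.exists_lt_two_rpow_mul hr
    (D := C * (E * M + M * E) / B)
    (ENNReal.div_ne_top (by finiteness) hB0)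
  let i₀ : Fin d := ⟨0, by omega⟩
  let i₁ : Fin d := ⟨1, hd⟩
  have hi : Disjoint ({i₀} : Finset (Fin d)) {i₁} := by simp [i₀, i₁]
  set a := MixedBesov.freqCenter n {i₀}
  set b := MixedBesov.freqCenter n {i₁}
  have hf := MixedBesov.besovNorm_of_fourier_near_freqCenter hφ₀ r p hq (F := ψ a)
    fun ξ hξ => (hsupp a ξ hξ).trans hlt
  have hg := MixedBesov.besovNorm_of_fourier_near_freqCenter hφ₀ r p hq (F := ψ b)
    fun ξ hξ => (hsupp b ξ hξ).trans hlt
  have hfg := MixedBesov.besovNorm_of_fourier_near_freqCenter hφ₀ r p hq (n := n)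
    (s := {i₀} ∪ {i₁}) (F := MixedBesov.schwartzMul (ψ a) (ψ b)) <| by
    intro ξ hξ
    obtain ⟨x, y, hx, hy, rfl⟩ := MixedBesov.exists_add_of_fourier_schwartzMul_ne_zero hξ
    rw [MixedBesov.freqCenter_union n hi, add_sub_add_comm]
    calc _ ≤ ‖x - a‖ + ‖y - b‖ := norm_add_le _ _
      _ < 1 / (4 * Real.pi) + 1 / (4 * Real.pi) := add_lt_add (hsupp a x hx) (hsupp b y hy)
      _ = 1 / (2 * Real.pi) := by ring
  have hBab : eLpNorm (MixedBesov.schwartzMul (ψ a) (ψ b)) p volume = B :=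
    eLpNorm_congr_norm_ae (.of_forall fun x => by
      simp [MixedBesov.schwartzMul_apply, hnorm a, hnorm b])
  set X := (2 : ℝ≥0∞) ^ (r * (n + 3)) with hX
  have hX0 : X ≠ 0 := by simp [hX]
  have hXtop : X ≠ ∞ := by
    rw [hX]
    exact ENNReal.rpow_ne_top_of_nonneg (by positivity) ENNReal.ofNat_ne_top
  rw [Finset.card_singleton, pow_one, hEp] at hf hg
  rw [Finset.card_union_of_disjoint hi, Finset.card_singleton, Finset.card_singleton, hBab] at hfg
  have hfin : X * E < ∞ := by finiteness
  have key := hC ((ψ a).toLp ∞ volume) ((ψ b).toLp ∞ volume)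
    (show MixedBesov.besovNorm _ _ _ _ _ < ∞ by rwa [hf])
    (show MixedBesov.besovNorm _ _ _ _ _ < ∞ by rwa [hg])
  rw [MixedBesov.toLp_smul_toLp, hf, hg, hfg, eLpNorm_congr_ae ((ψ a).coeFn_toLp ∞ volume),
    eLpNorm_congr_ae ((ψ b).coeFn_toLp ∞ volume), hEM, hEM] at key
  have hle : X * (X * B) ≤ X * (C * (E * M + M * E)) := by
    convert key using 1 <;> ring
  rw [ENNReal.mul_le_mul_iff_right hX0 hXtop] at hle
  exact absurd hn (not_lt.2 ((ENNReal.le_div_iff_mul_le (.inl hB0)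
    (.inl ((MixedBesov.schwartzMul (ψ 0) (ψ 0)).memLp p volume).eLpNorm_ne_top)).2 hle))
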